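/- Let $\lambda_j,\mu_j\in\mathbf C^*$ ($j=1,2,3$) with $\lambda_j\neq\mu_j$, and $\sigma\in\mathbf C^*$. Let $C_j\subset GL(4,\mathbf C)$ ($j=1,2,3$) be the conjugacy class of diagonalizable matrices with eigenvalues $\lambda_j,\lambda_j,\mu_j,\mu_j$, and let $C_4$ be the conjugacy class of matrices with the single eigenvalue $\sigma$ and Jordan blocks of sizes $2,1,1$. A non-genericity relation is an equality stating that, for some $m\in\{1,2,3\}$, the product of $m$ eigenvalues chosen from each of $C_1,\dots,C_4$ (each eigenvalue chosen at most as many times as its multiplicity) equals $1$. Assume that the eigenvalues are relatively generic but not generic, i.e. that the only non-genericity relation which they satisfy is the basic one $\lambda_1\mu_1\lambda_2\mu_2\lambda_3\mu_3\sigma^2=1$, and that they do satisfy it. Set \[ \mathcal V=\{(M_1,M_2,M_3,M_4) : M_j\in C_j,\ M_1M_2M_3M_4=I\}. \] Consider irreducible quadruples $(N_j)$ and $(P_j)$ of matrices in $GL(2,\mathbf C)$ with $N_1N_2N_3N_4=P_1P_2P_3P_4=I$, such that for $j=1,2,3$ both $N_j$ and $P_j$ are diagonalizable with eigenvalues $\lambda_j,\mu_j$,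 while $N_4=\sigma I$ and $P_4$ is conjugate to the Jordan block of size $2$ with eigenvalue $\sigma$. Let $\mathcal U\subset\mathcal V$ be the set of quadruples in $\mathcal V$ which are simultaneously conjugate to a quadruple of the form $\begin{pmatrix}N_j&0\\0&P_j\end{pmatrix}$, and let $\mathcal W\subset\mathcal V$ be the set of quadruples in $\mathcal V$ which are simultaneously conjugate to a quadruple of the form $\begin{pmatrix}N_j&R_j\\0&N_j\end{pmatrix}$ with $R_j\in gl(2,\mathbf C)$, where $(N_j)$ and $(P_j)$ are quadruples as above. Then $\mathcal W$ is contained in the closure of $\mathcal U$ in the usual topology of the space of quadruples of complex $4\times4$ matrices. -/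

import Mathlib

open Matrix

namespace DeligneSimpson

/-- Index set of the `4 × 4` matrices, presented as two groups of two indices so that a
`4 × 4` matrix has `2 × 2` blocks. -/
abbrev I4 : Type := Fin 2 ⊕ Fin 2

/-- Quadruples of square complex matrices; the indices `0, 1, 2, 3` number the four matrices. -/
abbrev Quad (ι : Type) : Type := Fin 4 → Matrix ι ι ℂ

/-- The representation given by the quadruple is irreducible: the space is non-zero and there is
no proper non-zero common invariant subspace. -/
def IsIrreducibleQuad {ι : Type} [Fintype ι] (A : Quad ι) : Prop :=
  Nonempty ι ∧ ∀ S : Submodule ℂ (ι → ℂ),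
    (∀ j, ∀ v ∈ S, A j *ᵥ v ∈ S) → S = ⊥ ∨ S = ⊤

/-! ### Eigenvalues and (relative) genericity -/

/-- The sets `Φ j` of indices, all of the same cardinality `m` with `0 < m < n`, give a
non-genericity relation: the product of the selected eigenvalues equals `1`. Here `ev j k` is the
`k`-th eigenvalue (repeated with multiplicity) of the `j`-th matrix. -/
def IsNongenericityRelation {ι : Type} [Fintype ι] (ev : Fin 4 → ι → ℂ)
    (Φ : Fin 4 → Finset ι) : Prop :=
  (∃ m : ℕ, 0 < m ∧ m < Fintype.card ι ∧ ∀ j, (Φ j).card = m) ∧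
    ∏ j, ∏ k ∈ Φ j, ev j k = 1

open Classical in
/-- `Φ` selects every eigenvalue of every matrix with exactly half of its multiplicity. -/
def HalvesMultiplicities {ι : Type} [Fintype ι] (ev : Fin 4 → ι → ℂ)
    (Φ : Fin 4 → Finset ι) : Prop :=
  ∀ j, ∀ c : ℂ, 2 * ((Φ j).filter (fun k => ev j k = c)).card =
    (Finset.univ.filter (fun k => ev j k = c)).card

/-- Eigenvalues that are generic: they satisfy no non-genericity relation. -/
def IsGeneric {ι : Type} [Fintype ι] (ev : Fin 4 → ι → ℂ) : Prop :=
  ∀ Φ : Fin 4 → Finset ι, ¬ IsNongenericityRelation ev Φ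

/-- Relatively generic eigenvalues, when the greatest common divisor of all multiplicities is `2`:
the only non-genericity relation they may satisfy is the basic one, in which all multiplicities
are divided by `2`. (The multiples of the basic relation involve all eigenvalues or more, so the
basic relation has no other non-genericity relation as a corollary.) -/
def IsRelativelyGeneric {ι : Type} [Fintype ι] (ev : Fin 4 → ι → ℂ) : Prop :=
  ∀ Φ : Fin 4 → Finset ι, IsNongenericityRelation ev Φ → HalvesMultiplicities ev Φ

/-- The eigenvalues, repeated with multiplicity, of the four conjugacy classes of the example:
`lam j, mu j`, each of multiplicity two, for the first three matrices, and `sig`, of multiplicity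
four, for the last one. -/
def eigenvalues (lam mu : Fin 3 → ℂ) (sig : ℂ) : Fin 4 → I4 → ℂ :=
  ![Sum.elim ![lam 0, mu 0] ![lam 0, mu 0],
    Sum.elim ![lam 1, mu 1] ![lam 1, mu 1],
    Sum.elim ![lam 2, mu 2] ![lam 2, mu 2],
    fun _ => sig]

/-! ### The variety and its strata -/

/-- The Jordan block of size two with eigenvalue `s`. -/
def jordanTwo (s : ℂ) : Matrix (Fin 2) (Fin 2) ℂ := !![s, 1; 0, s]

/-- The variety `V` of quadruples with product `1` in which the first three matrices are
diagonalizable with eigenvalues `lam j, lam j, mu j, mu j`, and the last one has the single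
eigenvalue `sig` with Jordan blocks of sizes `2, 1, 1`. -/
def V (lam mu : Fin 3 → ℂ) (sig : ℂ) : Set (Quad I4) :=
  {M | (∀ j : Fin 3, IsConj
          (diagonal (Sum.elim ![lam j, mu j] ![lam j, mu j]) : Matrix I4 I4 ℂ) (M j.castSucc)) ∧
    IsConj (fromBlocks (jordanTwo sig) 0 0 (sig • 1) : Matrix I4 I4 ℂ) (M 3) ∧
    M 0 * M 1 * M 2 * M 3 = 1}

/-- Irreducible quadruples of `2 × 2` matrices with product `1`, the first three diagonalizable
with eigenvalues `lam j, mu j`, the last one scalar, equal to `sig • 1`. -/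
def IsNQuad (lam mu : Fin 3 → ℂ) (sig : ℂ) (N : Quad (Fin 2)) : Prop :=
  (∀ j : Fin 3, IsConj (diagonal ![lam j, mu j]) (N j.castSucc)) ∧
    N 3 = sig • 1 ∧ N 0 * N 1 * N 2 * N 3 = 1 ∧ IsIrreducibleQuad N

/-- Irreducible quadruples of `2 × 2` matrices with product `1`, the first three diagonalizable
with eigenvalues `lam j, mu j`, the last one conjugate to a Jordan block of size two with
eigenvalue `sig`. -/
def IsPQuad (lam mu : Fin 3 → ℂ) (sig : ℂ) (P : Quad (Fin 2)) : Prop :=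
  (∀ j : Fin 3, IsConj (diagonal ![lam j, mu j]) (P j.castSucc)) ∧
    IsConj (jordanTwo sig) (P 3) ∧ P 0 * P 1 * P 2 * P 3 = 1 ∧ IsIrreducibleQuad P

/-- The stratum `U` of `V`: quadruples simultaneously conjugate to a block-diagonal quadruple with
diagonal blocks `N j`, `P j`. -/
def U (lam mu : Fin 3 → ℂ) (sig : ℂ) : Set (Quad I4) :=
  {M | M ∈ V lam mu sig ∧ ∃ N P : Quad (Fin 2), ∃ G : GL I4 ℂ,
    IsNQuad lam mu sig N ∧ IsPQuad lam mu sig P ∧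
    ∀ j, M j = (G : Matrix I4 I4 ℂ) * fromBlocks (N j) 0 0 (P j) *
      ((G⁻¹ : GL I4 ℂ) : Matrix I4 I4 ℂ)}

/-- The stratum `W` of `V`: quadruples simultaneously conjugate to a block upper-triangular
quadruple with both diagonal blocks equal to `N j`. Such a quadruple is not a direct sum of the
two equivalent representations, because its last matrix is not scalar. -/
def W (lam mu : Fin 3 → ℂ) (sig : ℂ) : Set (Quad I4) :=
  {M | M ∈ V lam mu sig ∧ ∃ N R : Quad (Fin 2), ∃ G : GL I4 ℂ,
    IsNQuad lam mu sig N ∧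
    ∀ j, M j = (G : Matrix I4 I4 ℂ) * fromBlocks (N j) (R j) 0 (N j) *
      ((G⁻¹ : GL I4 ℂ) : Matrix I4 I4 ℂ)}

end DeligneSimpson

namespace DeligneSimpson

open Filter Topology

/-! Up to conjugation a point of `W` is the block matrix with diagonal blocks `N j`, `N j` and
corner `R j`. Its conjugacy classes force `R j = [Z j, N j]` for the first three indices and make `R
3` a nonzero matrix of square zero, so `R` is a first-order deformation of `N` inside the classes of
the `P` quadruples. If it integrates to a curve `P t` with `P 0 = N` and velocity `R`, then the
blocks `N j`, `t⁻¹ • (P t j - N j)`, `P t j` converge to the given point. For `t ≠ 0` they are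
conjugate to the direct sum of `N` and `P t` by a block unipotent matrix, hence lie in `U`.

The curve comes from the implicit function theorem (`exists_conj_curves`), applied to the product of
three conjugates times a scalar `1 + s`. Irreducibility of `N` and Schur's lemma make its derivative
onto (`exists_smul_add_sum_eq`); determinants then force `s = 0`. Relative genericity makes `P t`
irreducible. -/

/-! ### Curves from the implicit function theorem. -/

/-- If the strict derivative `f'` of `f` at `0` is onto, the line `f 0 + t • f' v` lifts to a curve
with tangent vector `v`. -/
lemma exists_curve_of_surjective {E F : Type*} [NormedAddCommGroup E] [NormedSpace ℂ E]
    [NormedAddCommGroup F] [NormedSpace ℂ F] [FiniteDimensional ℂ F]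
    {f : E → F} {f' : E →L[ℂ] F} (hf : HasStrictFDerivAt f f' 0)
    (hsurj : Function.Surjective f') (v : E) :
    ∃ x : ℂ → E, x 0 = 0 ∧ HasDerivAt x v 0 ∧ ∀ᶠ t in 𝓝 (0 : ℂ), f (x t) = f 0 + t • f' v := by
  have : CompleteSpace F := FiniteDimensional.complete ℂ F
  obtain ⟨b, hb⟩ := f'.toLinearMap.exists_rightInverse_of_surjective
    (LinearMap.range_eq_top.2 hsurj)
  let B : F →L[ℂ] E := LinearMap.toContinuousLinearMap b
  have hB : ∀ y, f' (B y) = y := fun y => LinearMap.congr_fun hb y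
  -- The equation `f (t • v + B y) - t • f' v = f 0` is solved for `y = ψ t`. At the origin its
  -- `t`-derivative vanishes and its `y`-derivative is the identity, so `ψ' = 0` and the correction
  -- `B (ψ t)` leaves the velocity `v` unchanged.
  let l : ℂ × F →L[ℂ] E :=
    (ContinuousLinearMap.toSpanSingleton ℂ v).comp (.fst ℂ ℂ F) + B.comp (.snd ℂ ℂ F)
  let k : ℂ × F →L[ℂ] F := (ContinuousLinearMap.toSpanSingleton ℂ (f' v)).comp (.fst ℂ ℂ F)
  have hg : HasStrictFDerivAt (fun p : ℂ × F => f (l p) - k p) (f'.comp l - k) 0 := by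
    refine HasStrictFDerivAt.sub ?_ k.hasStrictFDerivAt
    refine HasStrictFDerivAt.comp (0 : ℂ × F) ?_ l.hasStrictFDerivAt
    simpa using hf
  have h2 : (f'.comp l - k) ∘L .inr ℂ ℂ F = .id ℂ F := by
    ext y; simp [l, k, hB]
  have h1 : (f'.comp l - k) ∘L .inl ℂ ℂ F = 0 := by
    ext; simp [l, k]
  have hinv : ((f'.comp l - k) ∘L .inr ℂ ℂ F).IsInvertible := by
    rw [h2]; exact ⟨ContinuousLinearEquiv.refl ℂ F, rfl⟩
  have hd := hg.hasStrictFDerivAt_implicitFunctionOfProdDomain hinv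
  have he := hg.eventually_apply_implicitFunctionOfProdDomain hinv
  have h0 := (hg.eventually_apply_eq_iff_implicitFunctionOfProdDomain hinv).self_of_nhds.mp rfl
  set ψ := hg.implicitFunctionOfProdDomain hinv
  rw [h1, ContinuousLinearMap.comp_zero] at hd
  have hψ : HasDerivAt ψ 0 0 := by simpa using hd.hasFDerivAt.hasDerivAt
  refine ⟨fun t => t • v + B (ψ t), ?_, ?_, ?_⟩
  · simpa using congrArg B h0
  · have := ((hasDerivAt_id (0 : ℂ)).smul_const v).add (B.hasFDerivAt.comp_hasDerivAt 0 hψ)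
    simpa [Function.comp_def, Pi.add_def] using this
  · filter_upwards [he] with t ht
    simpa [l, k, sub_eq_iff_eq_add] using ht

/-- Lifting a line through a product of three elements of a Banach algebra, up to scalars, by
moving each factor in its conjugacy class with prescribed velocity. -/
lemma exists_conj_curves {A : Type*} [NormedRing A] [NormedAlgebra ℂ A] [FiniteDimensional ℂ A]
    (N Z : Fin 3 → A)
    (hsurj : ∀ Y : A, ∃ (s : ℂ) (w : Fin 3 → A), s • (N 0 * N 1 * N 2) +
      ((w 0 * N 0 - N 0 * w 0) * N 1 * N 2 + N 0 * (w 1 * N 1 - N 1 * w 1) * N 2 +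
        N 0 * N 1 * (w 2 * N 2 - N 2 * w 2)) = Y) :
    ∃ (s : ℂ → ℂ) (P : Fin 3 → ℂ → A), Tendsto s (𝓝 0) (𝓝 0) ∧ (∀ j, P j 0 = N j) ∧
      (∀ j, HasDerivAt (P j) (Z j * N j - N j * Z j) 0) ∧ (∀ j t, IsConj (N j) (P j t)) ∧
      ∀ᶠ t in 𝓝 (0 : ℂ), (1 + s t) • (P 0 t * P 1 t * P 2 t) = N 0 * N 1 * N 2 +
        t • ((Z 0 * N 0 - N 0 * Z 0) * N 1 * N 2 + N 0 * (Z 1 * N 1 - N 1 * Z 1) * N 2 +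
          N 0 * N 1 * (Z 2 * N 2 - N 2 * Z 2)) := by
  have : CompleteSpace A := FiniteDimensional.complete ℂ A
  let _ : NormedAlgebra ℚ A := NormedAlgebra.restrictScalars ℚ ℂ A
  -- Conjugating by exponentials stays in the class exactly, for every `z`, and has derivative `z ↦
  -- [z, N j]` at `0`.
  let c : Fin 3 → A → A := fun j z => NormedSpace.exp z * N j * NormedSpace.exp (-z)
  let ad : Fin 3 → A →L[ℂ] A := fun j =>
    (ContinuousLinearMap.mul ℂ A).flip (N j) - ContinuousLinearMap.mul ℂ A (N j)
  have hc0 : ∀ j, c j 0 = N j := fun j => by simp [c]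
  have hc : ∀ j, HasStrictFDerivAt (c j) (ad j) 0 := by
    intro j
    have e : HasStrictFDerivAt (NormedSpace.exp : A → A) (1 : A →L[ℂ] A) 0 :=
      hasStrictFDerivAt_exp_zero
    have e' : HasStrictFDerivAt (fun z : A => NormedSpace.exp (-z)) (-1 : A →L[ℂ] A) 0 := by
      have h := HasStrictFDerivAt.comp (𝕜 := ℂ) (f := fun z : A => -z) (g := NormedSpace.exp)
        (g' := 1) (0 : A) (by simpa using e) (hasStrictFDerivAt_id (0 : A)).neg
      exact h.congr_fderiv (by ext z; simp)
    refine ((e.mul_const' (N j)).mul' e').congr_fderiv ?_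
    ext z
    simp [ad, sub_eq_neg_add]
  let pr : Fin 3 → (ℂ × (Fin 3 → A)) →L[ℂ] A := fun j =>
    (ContinuousLinearMap.proj j).comp (.snd ℂ ℂ (Fin 3 → A))
  have hq : ∀ j, HasStrictFDerivAt (fun p : ℂ × (Fin 3 → A) => c j (p.2 j)) ((ad j).comp (pr j)) 0 :=
    fun j => HasStrictFDerivAt.comp (g := c j) (0 : ℂ × (Fin 3 → A)) (by simpa using hc j)
      (pr j).hasStrictFDerivAt
  have hs : HasStrictFDerivAt (fun p : ℂ × (Fin 3 → A) => 1 + p.1) (.fst ℂ ℂ (Fin 3 → A)) 0 :=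
    (ContinuousLinearMap.fst ℂ ℂ (Fin 3 → A)).hasStrictFDerivAt.const_add 1
  have hf : HasStrictFDerivAt (fun p : ℂ × (Fin 3 → A) =>
      (1 + p.1) • (c 0 (p.2 0) * c 1 (p.2 1) * c 2 (p.2 2))) _ 0 :=
    hs.smul (((hq 0).mul' (hq 1)).mul' (hq 2))
  obtain ⟨D, hD, hDv⟩ : ∃ D : ℂ × (Fin 3 → A) →L[ℂ] A, HasStrictFDerivAt
      (fun p : ℂ × (Fin 3 → A) => (1 + p.1) • (c 0 (p.2 0) * c 1 (p.2 1) * c 2 (p.2 2))) D 0 ∧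
      ∀ v, D v = v.1 • (N 0 * N 1 * N 2) +
        ((v.2 0 * N 0 - N 0 * v.2 0) * N 1 * N 2 + N 0 * (v.2 1 * N 1 - N 1 * v.2 1) * N 2 +
          N 0 * N 1 * (v.2 2 * N 2 - N 2 * v.2 2)) := by
    refine ⟨_, hf, fun v => ?_⟩
    simp [hc0, ad, pr]
    noncomm_ring
  obtain ⟨x, hx0, hx, he⟩ := exists_curve_of_surjective hD
    (fun Y => by obtain ⟨s, w, h⟩ := hsurj Y; exact ⟨(s, w), by rw [hDv]; exact h⟩) (0, Z)
  refine ⟨fun t => (x t).1, fun j t => c j ((x t).2 j), ?_, ?_, ?_, ?_, ?_⟩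
  · have := continuous_fst.continuousAt.comp hx.continuousAt
    simpa [ContinuousAt, hx0, Function.comp_def] using this
  · intro j; simp [hx0, hc0]
  · intro j
    have h : HasFDerivAt (fun p : ℂ × (Fin 3 → A) => c j (p.2 j)) ((ad j).comp (pr j)) (x 0) := by
      rw [hx0]; exact (hq j).hasFDerivAt
    have := h.comp_hasDerivAt 0 hx
    simpa [ad, pr, Function.comp_def] using this
  · intro j t
    let y := (x t).2 j
    have h1 : NormedSpace.exp y * NormedSpace.exp (-y) = 1 := by
      rw [← NormedSpace.exp_add_of_commute (Commute.refl y).neg_right, add_neg_cancel,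
        NormedSpace.exp_zero]
    have h2 : NormedSpace.exp (-y) * NormedSpace.exp y = 1 := by
      rw [← NormedSpace.exp_add_of_commute (Commute.refl y).neg_left, neg_add_cancel,
        NormedSpace.exp_zero]
    refine ⟨⟨_, _, h1, h2⟩, ?_⟩
    change NormedSpace.exp y * N j =
      NormedSpace.exp y * N j * NormedSpace.exp (-y) * NormedSpace.exp y
    rw [mul_assoc _ (NormedSpace.exp (-y)), h2, mul_one]
  · filter_upwards [he] with t ht
    rw [ht, hDv]
    simp [hc0]

/-! ### Surjectivity of the tangent map at an irreducible quadruple. -/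

/-- Schur's lemma. -/
lemma IsIrreducibleQuad.exists_eq_smul_one {ι : Type} [Fintype ι] [DecidableEq ι] {A : Quad ι}
    (hA : IsIrreducibleQuad A) {Y : Matrix ι ι ℂ} (hY : ∀ j, Commute Y (A j)) :
    ∃ y : ℂ, Y = y • 1 := by
  have := hA.1
  obtain ⟨y, hy⟩ := Module.End.exists_eigenvalue (Matrix.toLin' Y)
  have hinv : ∀ j, ∀ v ∈ Module.End.eigenspace (Matrix.toLin' Y) y,
      A j *ᵥ v ∈ Module.End.eigenspace (Matrix.toLin' Y) y := by
    intro j v hv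
    rw [Module.End.mem_eigenspace_iff, Matrix.toLin'_apply] at hv ⊢
    rw [mulVec_mulVec, (hY j).eq, ← mulVec_mulVec, hv, mulVec_smul]
  refine ⟨y, ?_⟩
  rcases hA.2 _ hinv with h | h
  · exact absurd h hy
  · refine Matrix.toLin'.injective (LinearMap.ext fun v => ?_)
    have hv : v ∈ Module.End.eigenspace (Matrix.toLin' Y) y := h ▸ Submodule.mem_top
    rw [Module.End.mem_eigenspace_iff] at hv
    simpa using hv

/-- A functional vanishing on the range is `X ↦ tr (T X)`. Vanishing on the commutator directions
makes `T` commute with every `N j`, so `T` is scalar by Schur; vanishing on the direction of `s`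
then gives `T = 0`. Without `s` only traceless matrices would be reached, since the product is
scalar. -/
lemma exists_smul_add_sum_eq {N : Quad (Fin 2)} (hN : IsIrreducibleQuad N) {c : ℂ} (hc : c ≠ 0)
    (hprod : N 0 * N 1 * N 2 = c • 1) {d : ℂ} (h3 : N 3 = d • 1) (Y : Matrix (Fin 2) (Fin 2) ℂ) :
    ∃ (s : ℂ) (w : Fin 3 → Matrix (Fin 2) (Fin 2) ℂ), s • (N 0 * N 1 * N 2) +
      ((w 0 * N 0 - N 0 * w 0) * N 1 * N 2 + N 0 * (w 1 * N 1 - N 1 * w 1) * N 2 +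
        N 0 * N 1 * (w 2 * N 2 - N 2 * w 2)) = Y := by
  let L : (ℂ × (Fin 3 → Matrix (Fin 2) (Fin 2) ℂ)) →ₗ[ℂ] Matrix (Fin 2) (Fin 2) ℂ :=
    { toFun := fun p => p.1 • (N 0 * N 1 * N 2) +
        ((p.2 0 * N 0 - N 0 * p.2 0) * N 1 * N 2 + N 0 * (p.2 1 * N 1 - N 1 * p.2 1) * N 2 +
          N 0 * N 1 * (p.2 2 * N 2 - N 2 * p.2 2))
      map_add' := fun p q => by simp [add_smul]; noncomm_ring
      map_smul' := fun a p => by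
        simp [mul_smul, ← smul_sub] }
  suffices h : LinearMap.range L = ⊤ by
    obtain ⟨p, hp⟩ := LinearMap.range_eq_top.1 h Y
    exact ⟨p.1, p.2, hp⟩
  by_contra hlt
  obtain ⟨φ, hφ0, hφ⟩ := Submodule.exists_le_ker_of_lt_top _ (lt_top_iff_ne_top.2 hlt)
  apply hφ0
  -- represent `φ` by the trace pairing
  let T : Matrix (Fin 2) (Fin 2) ℂ := Matrix.of fun i j => φ (Matrix.single j i 1)
  have hT : ∀ X, φ X = (T * X).trace := by
    intro X
    conv_lhs => rw [matrix_eq_sum_single X]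
    simp only [map_sum, trace, diag, mul_apply, T, of_apply]
    rw [Finset.sum_comm]
    refine Finset.sum_congr rfl fun i _ => Finset.sum_congr rfl fun j _ => ?_
    rw [← mul_one (X j i), ← smul_eq_mul, ← smul_single, map_smul, smul_eq_mul, mul_comm]
    simp
  have hL : ∀ p, (T * L p).trace = 0 := fun p => by
    rw [← hT]; exact hφ (LinearMap.mem_range_self L p)
  have hcyc1 : N 1 * N 2 * N 0 = c • 1 := by
    have h : N 0 * (c⁻¹ • (N 1 * N 2)) = 1 := by
      rw [mul_smul_comm, ← mul_assoc, hprod, smul_smul, inv_mul_cancel₀ hc, one_smul]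
    have h' := mul_eq_one_comm.1 h
    rw [smul_mul_assoc] at h'
    rw [← h', smul_smul, mul_inv_cancel₀ hc, one_smul]
  have hcyc2 : N 2 * (N 0 * N 1) = c • 1 := by
    have h : (N 0 * N 1) * (c⁻¹ • N 2) = 1 := by
      rw [mul_smul_comm, hprod, smul_smul, inv_mul_cancel₀ hc, one_smul]
    have h' := mul_eq_one_comm.1 h
    rw [smul_mul_assoc] at h'
    rw [← h', smul_smul, mul_inv_cancel₀ hc, one_smul]
  have hinj : ∀ (u v : Matrix (Fin 2) (Fin 2) ℂ), c • u = c • v → u = v :=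
    fun u v h => smul_right_injective _ hc h
  -- Varying only the first factor, and then only the second, already yields all the commutation
  -- relations.
  have e0 : c • T = N 1 * N 2 * (T * N 0) := by
    refine ext_iff_trace_mul_right.2 fun w => ?_
    have h := hL (0, Pi.single 0 w)
    simp only [L, LinearMap.coe_mk, AddHom.coe_mk, zero_smul, zero_add, Pi.single_eq_same] at h
    rw [Pi.single_eq_of_ne (by decide), Pi.single_eq_of_ne (by decide)] at h
    have h' : T * ((w * N 0 - N 0 * w) * N 1 * N 2) =
        T * w * (N 0 * N 1 * N 2) - (T * N 0 * w) * (N 1 * N 2) := by noncomm_ring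
    simp only [zero_mul, mul_zero, sub_zero, add_zero] at h
    rw [h', trace_sub, hprod, sub_eq_zero, trace_mul_comm _ (N 1 * N 2), mul_smul_comm, mul_one,
      ← smul_mul_assoc] at h
    rw [h, mul_assoc (N 1 * N 2)]
  have e1 : N 1 * N 2 * (T * N 0) = N 2 * (T * (N 0 * N 1)) := by
    refine ext_iff_trace_mul_right.2 fun w => ?_
    have h := hL (0, Pi.single 1 w)
    simp only [L, LinearMap.coe_mk, AddHom.coe_mk, zero_smul, zero_add, Pi.single_eq_same] at h
    rw [Pi.single_eq_of_ne (by decide), Pi.single_eq_of_ne (by decide)] at h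
    have h' : T * (N 0 * (w * N 1 - N 1 * w) * N 2) =
        (T * N 0 * w) * (N 1 * N 2) - (T * (N 0 * N 1) * w) * N 2 := by noncomm_ring
    simp only [zero_mul, mul_zero, sub_zero, add_zero, zero_add] at h
    rw [h', trace_sub, sub_eq_zero, trace_mul_comm _ (N 1 * N 2), trace_mul_comm _ (N 2)] at h
    rw [mul_assoc (N 1 * N 2), h, mul_assoc (N 2)]
  have c0 : T * N 0 = N 0 * T := by
    apply hinj
    calc c • (T * N 0) = (N 0 * N 1 * N 2) * (T * N 0) := by rw [hprod, smul_mul_assoc, one_mul]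
      _ = N 0 * (c • T) := by rw [e0]; simp only [mul_assoc]
      _ = _ := by rw [mul_smul_comm]
  have c01 : T * (N 0 * N 1) = N 0 * N 1 * T := by
    apply hinj
    calc c • (T * (N 0 * N 1)) = (N 0 * N 1 * N 2) * (T * (N 0 * N 1)) := by
          rw [hprod, smul_mul_assoc, one_mul]
      _ = N 0 * N 1 * (c • T) := by rw [e0, e1]; simp only [mul_assoc]
      _ = _ := by rw [mul_smul_comm]
  have c1 : T * N 1 = N 1 * T := by
    apply hinj
    calc c • (T * N 1) = (N 1 * N 2 * N 0) * (T * N 1) := by rw [hcyc1, smul_mul_assoc, one_mul]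
      _ = N 1 * N 2 * (T * (N 0 * N 1)) := by rw [← mul_assoc T, c0]; simp only [mul_assoc]
      _ = (N 1 * N 2 * N 0) * (N 1 * T) := by rw [c01]; simp only [mul_assoc]
      _ = _ := by rw [hcyc1, smul_mul_assoc, one_mul]
  have c2 : T * N 2 = N 2 * T := by
    apply hinj
    calc c • (T * N 2) = (N 2 * (N 0 * N 1)) * (T * N 2) := by rw [hcyc2, smul_mul_assoc, one_mul]
      _ = N 2 * (T * (N 0 * N 1 * N 2)) := by rw [← mul_assoc T, c01]; simp only [mul_assoc]
      _ = _ := by rw [hprod, mul_smul_comm, mul_one, mul_smul_comm]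
  obtain ⟨y, hy⟩ := hN.exists_eq_smul_one (Y := T) fun j => by
    fin_cases j
    · exact c0
    · exact c1
    · exact c2
    · change T * N 3 = N 3 * T
      rw [h3, mul_smul_comm, smul_mul_assoc, mul_one, one_mul]
  have h := hL (1, 0)
  simp only [L, LinearMap.coe_mk, AddHom.coe_mk, one_smul, hprod, hy] at h
  have hy0 : y = 0 := by simpa [hc] using h
  refine LinearMap.ext fun X => ?_
  rw [hT, hy, hy0]
  simp

/-! ### What the conjugacy classes impose on the off-diagonal blocks. -/

/-- The quadratic `(x - l)(x - m)` kills the block matrix, so its corner gives `N R + R N = (l + m)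
R`: in an eigenbasis of `N`, `R` has zero diagonal. On such matrices the square of `ad N` is
multiplication by `(l - m) ^ 2`, whence the choice of `Z`. -/
lemma exists_commutator_of_isConj_diagonal {l m : ℂ} (hlm : l ≠ m)
    {N R : Matrix (Fin 2) (Fin 2) ℂ}
    (h : IsConj (diagonal (Sum.elim ![l, m] ![l, m]) : Matrix I4 I4 ℂ) (fromBlocks N R 0 N)) :
    ∃ Z, R = Z * N - N * Z := by
  obtain ⟨g, hg⟩ := h
  have hM : (fromBlocks N R 0 N : Matrix I4 I4 ℂ) =
      g * diagonal (Sum.elim ![l, m] ![l, m]) * (g⁻¹ : GL I4 ℂ) := by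
    rw [hg.eq, mul_assoc, ← Units.val_mul, mul_inv_cancel, Units.val_one, mul_one]
  have hD : (diagonal (Sum.elim ![l, m] ![l, m]) : Matrix I4 I4 ℂ) *
      diagonal (Sum.elim ![l, m] ![l, m]) = (l + m) • diagonal (Sum.elim ![l, m] ![l, m]) -
        (l * m) • 1 := by
    ext i j
    rcases i with i | i <;> rcases j with j | j <;> fin_cases i <;> fin_cases j <;>
      simp <;> ring
  have hgg : ((g⁻¹ : GL I4 ℂ) : Matrix I4 I4 ℂ) * g = 1 := by
    rw [← Units.val_mul, inv_mul_cancel, Units.val_one]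
  have hgg' : (g : Matrix I4 I4 ℂ) * (g⁻¹ : GL I4 ℂ) = 1 := by
    rw [← Units.val_mul, mul_inv_cancel, Units.val_one]
  have hMM : (fromBlocks N R 0 N : Matrix I4 I4 ℂ) * fromBlocks N R 0 N =
      (l + m) • fromBlocks N R 0 N - (l * m) • 1 := by
    rw [hM]
    calc _ = (g : Matrix I4 I4 ℂ) * diagonal (Sum.elim ![l, m] ![l, m]) *
        (((g⁻¹ : GL I4 ℂ) : Matrix I4 I4 ℂ) * g) * diagonal (Sum.elim ![l, m] ![l, m]) *
          (g⁻¹ : GL I4 ℂ) := by simp only [mul_assoc]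
      _ = g * (diagonal (Sum.elim ![l, m] ![l, m]) * diagonal (Sum.elim ![l, m] ![l, m])) *
          (g⁻¹ : GL I4 ℂ) := by rw [hgg]; simp only [mul_assoc, one_mul]
      _ = _ := by
        rw [hD, mul_sub, sub_mul, mul_smul_comm, mul_smul_comm, smul_mul_assoc, smul_mul_assoc,
          mul_one, hgg']
  rw [fromBlocks_multiply, ← fromBlocks_one, fromBlocks_smul, fromBlocks_smul, sub_eq_add_neg,
    fromBlocks_neg, fromBlocks_add,
    fromBlocks_inj] at hMM
  obtain ⟨h1, h2, -, -⟩ := hMM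
  simp only [mul_zero, add_zero, smul_zero, neg_zero, ← sub_eq_add_neg] at h1 h2
  have hd : (l - m) ^ 2 ≠ 0 := pow_ne_zero 2 (sub_ne_zero.2 hlm)
  refine ⟨((l - m) ^ 2)⁻¹ • (R * N - N * R), ?_⟩
  rw [smul_mul_assoc, mul_smul_comm, ← smul_sub, eq_inv_smul_iff₀ hd]
  have hRN : R * N = (l + m) • R - N * R := by rw [← h2]; abel
  have hNRN : N * R * N = (l * m) • R := by
    rw [mul_assoc, hRN, mul_sub, ← mul_assoc, h1, sub_mul, mul_smul_comm, smul_mul_assoc,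
      smul_mul_assoc, one_mul]
    abel
  have hNNR : N * (N * R) = (l + m) • (N * R) - (l * m) • R := by
    rw [← mul_assoc, h1, sub_mul, smul_mul_assoc, smul_mul_assoc, one_mul]
  have hRNN : R * N * N = (l + m) • (R * N) - (l * m) • R := by
    rw [mul_assoc, h1, mul_sub, mul_smul_comm, mul_smul_comm, mul_one]
  rw [sub_mul, mul_sub, hNRN, ← mul_assoc, hNRN, hNNR, hRNN, hRN]
  module

/-- Subtracting `s` leaves a conjugate of a matrix unit, of rank one; its corner `R` is therefore a
column times a row. -/
lemma ne_zero_and_det_eq_zero_of_isConj {s : ℂ} {R : Matrix (Fin 2) (Fin 2) ℂ}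
    (h : IsConj (fromBlocks (jordanTwo s) 0 0 (s • 1) : Matrix I4 I4 ℂ)
      (fromBlocks (s • 1) R 0 (s • 1))) : R ≠ 0 ∧ R.det = 0 := by
  obtain ⟨g, hg⟩ := h
  have hJ : (fromBlocks (jordanTwo s) 0 0 (s • 1) : Matrix I4 I4 ℂ) =
      s • 1 + single (Sum.inl 0) (Sum.inl 1) 1 := by
    ext i j
    rcases i with i | i <;> rcases j with j | j <;> fin_cases i <;> fin_cases j <;>
      simp [jordanTwo, one_apply]
  have hR : (fromBlocks (s • 1) R 0 (s • 1) : Matrix I4 I4 ℂ) = s • 1 + fromBlocks 0 R 0 0 := by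
    rw [← fromBlocks_one, fromBlocks_smul, fromBlocks_add]; simp
  have hgg' : (g : Matrix I4 I4 ℂ) * (g⁻¹ : GL I4 ℂ) = 1 := by
    rw [← Units.val_mul, mul_inv_cancel, Units.val_one]
  have he : (g : Matrix I4 I4 ℂ) * single (Sum.inl 0) (Sum.inl 1) 1 = (fromBlocks 0 R 0 0 : Matrix I4 I4 ℂ) * (g : Matrix I4 I4 ℂ) := by
    have := hg.eq
    rw [hJ, hR, mul_add, add_mul, mul_smul_comm, smul_mul_assoc, mul_one, one_mul] at this
    exact add_left_cancel this
  have he' : (fromBlocks 0 R 0 0 : Matrix I4 I4 ℂ) =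
      (g : Matrix I4 I4 ℂ) * single (Sum.inl 0) (Sum.inl 1) 1 * ((g⁻¹ : GL I4 ℂ) : Matrix I4 I4 ℂ) := by
    rw [he, mul_assoc, hgg', mul_one]
  constructor
  · intro hR0
    rw [hR0, fromBlocks_zero, zero_mul] at he
    have h0 : (single (Sum.inl 0) (Sum.inl 1) 1 : Matrix I4 I4 ℂ) = 0 := by
      rw [← one_mul (single _ _ _), ← Units.val_one, ← inv_mul_cancel g, Units.val_mul, mul_assoc,
        he, mul_zero]
    have := congrFun (congrFun h0 (Sum.inl 0)) (Sum.inl 1)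
    simp at this
  · have hij : ∀ i j, R i j = (g : Matrix I4 I4 ℂ) (Sum.inl i) (Sum.inl 0) *
        ((g⁻¹ : GL I4 ℂ) : Matrix I4 I4 ℂ) (Sum.inl 1) (Sum.inr j) := by
      intro i j
      have := congrFun (congrFun he' (Sum.inl i)) (Sum.inr j)
      rw [fromBlocks_apply₁₂] at this
      rw [this, mul_apply]
      simp [mul_apply, single_apply]
    rw [det_fin_two]
    simp only [hij]
    ring

/-- A matrix of size two with the single eigenvalue `s`, not scalar, is a Jordan block. -/
lemma isConj_jordanTwo {s : ℂ} {R : Matrix (Fin 2) (Fin 2) ℂ} (h0 : R ≠ 0) (htr : R.trace = 0)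
    (hdet : R.det = 0) : IsConj (jordanTwo s) (s • 1 + R) := by
  rw [trace_fin_two] at htr
  rw [det_fin_two] at hdet
  have h11 : R 1 1 = - R 0 0 := by linear_combination htr
  rw [h11] at hdet
  have key : ∀ g : Matrix (Fin 2) (Fin 2) ℂ, g.det ≠ 0 → g * !![0, 1; 0, 0] = R * g →
      IsConj (jordanTwo s) (s • 1 + R) := by
    intro g hg h
    refine ⟨GeneralLinearGroup.mkOfDetNeZero g hg, ?_⟩
    change g * jordanTwo s = (s • 1 + R) * g
    have : jordanTwo s = s • 1 + !![0, 1; 0, 0] := by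
      ext i j; fin_cases i <;> fin_cases j <;> simp [jordanTwo]
    rw [this, mul_add, add_mul, h, mul_smul_comm, smul_mul_assoc, mul_one, one_mul]
  -- The Jordan basis is `(R e, e)` for a standard basis vector `e` with `R e ≠ 0`: the second one
  -- here, the first one otherwise.
  by_cases h10 : R 1 0 = 0
  · have h00 : R 0 0 = 0 := by
      rw [h10] at hdet
      have : R 0 0 * R 0 0 = 0 := by linear_combination -hdet
      simpa using this
    have h01 : R 0 1 ≠ 0 := by
      intro h01
      apply h0
      ext i j; fin_cases i <;> fin_cases j <;> simp [h00, h01, h10, h11]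
    refine key !![R 0 1, 0; 0, 1] (by simp [h01]) ?_
    ext i j; fin_cases i <;> fin_cases j <;> simp [mul_apply, h00, h10, h11]
  · refine key !![R 0 0, 1; R 1 0, 0] (by simp [h10]) ?_
    ext i j; fin_cases i <;> fin_cases j <;> simp [mul_apply, h11]
    · linear_combination hdet
    · ring

/-! ### Irreducibility from relative genericity. -/

lemma sq_eq_of_isConj_diagonal {l m : ℂ} {A : Matrix (Fin 2) (Fin 2) ℂ}
    (h : IsConj (diagonal ![l, m]) A) : A * A = (l + m) • A - (l * m) • 1 := by
  obtain ⟨g, hg⟩ := h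
  have hD : (diagonal ![l, m] : Matrix (Fin 2) (Fin 2) ℂ) * diagonal ![l, m] =
      (l + m) • diagonal ![l, m] - (l * m) • 1 := by
    ext i j
    fin_cases i <;> fin_cases j <;> simp <;> ring
  have h2 : SemiconjBy (g : Matrix (Fin 2) (Fin 2) ℂ)
      (diagonal ![l, m] * diagonal ![l, m]) (A * A) := hg.mul_right hg
  have h3 : A * A * (g : Matrix (Fin 2) (Fin 2) ℂ) = ((l + m) • A - (l * m) • 1) * g := by
    rw [← h2.eq, hD, mul_sub, sub_mul, mul_smul_comm, smul_mul_assoc, hg.eq, mul_smul_comm,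
      smul_mul_assoc, mul_one, one_mul]
  exact g.isUnit.mul_right_cancel h3

/-- Written with `s + s` and `s * s` so that `eq_or_eq_of_mulVec_eq_smul` applies with `l = m = s`.
-/
lemma sq_eq_of_isConj_jordanTwo {s : ℂ} {A : Matrix (Fin 2) (Fin 2) ℂ}
    (h : IsConj (jordanTwo s) A) : A * A = (s + s) • A - (s * s) • 1 := by
  obtain ⟨g, hg⟩ := h
  have hD : jordanTwo s * jordanTwo s = (s + s) • jordanTwo s - (s * s) • 1 := by
    ext i j
    fin_cases i <;> fin_cases j <;> simp [jordanTwo] <;> ring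
  have h2 : SemiconjBy (g : Matrix (Fin 2) (Fin 2) ℂ)
      (jordanTwo s * jordanTwo s) (A * A) := hg.mul_right hg
  have h3 : A * A * (g : Matrix (Fin 2) (Fin 2) ℂ) = ((s + s) • A - (s * s) • 1) * g := by
    rw [← h2.eq, hD, mul_sub, sub_mul, mul_smul_comm, smul_mul_assoc, hg.eq, mul_smul_comm,
      smul_mul_assoc, mul_one, one_mul]
  exact g.isUnit.mul_right_cancel h3

lemma eq_or_eq_of_mulVec_eq_smul {l m c : ℂ} {A : Matrix (Fin 2) (Fin 2) ℂ}
    (h : A * A = (l + m) • A - (l * m) • 1) {v : Fin 2 → ℂ} (hv : v ≠ 0) (hc : A *ᵥ v = c • v) :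
    c = l ∨ c = m := by
  have h1 := congrArg (· *ᵥ v) h
  simp only [← mulVec_mulVec, sub_mulVec, smul_mulVec, hc, mulVec_smul, one_mulVec] at h1
  have h2 : ((c - l) * (c - m)) • v = 0 := by
    have : ((c - l) * (c - m)) • v = c • c • v - ((l + m) • c • v - (l * m) • v) := by module
    rw [this, h1, sub_self]
  rcases mul_eq_zero.1 ((smul_eq_zero.1 h2).resolve_right hv) with h | h
  · exact Or.inl (sub_eq_zero.1 h)
  · exact Or.inr (sub_eq_zero.1 h)

/-- Relative genericity excludes common eigenvectors. -/
lemma isIrreducibleQuad_of_isRelativelyGeneric {lam mu : Fin 3 → ℂ} {sig : ℂ}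
    (hrel : IsRelativelyGeneric (eigenvalues lam mu sig)) {P : Quad (Fin 2)}
    (hP : ∀ j : Fin 3, IsConj (diagonal ![lam j, mu j]) (P j.castSucc))
    (h3 : IsConj (jordanTwo sig) (P 3)) (hprod : P 0 * P 1 * P 2 * P 3 = 1) :
    IsIrreducibleQuad P := by
  refine ⟨inferInstance, fun S hS => ?_⟩
  by_contra! hne
  obtain ⟨hbot, htop⟩ := hne
  have hlt : Module.finrank ℂ S < 2 := by
    simpa using Submodule.finrank_lt htop
  obtain ⟨v, hv⟩ := finrank_le_one_iff.1 (Nat.lt_succ_iff.1 hlt)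
  have hv0 : (v : Fin 2 → ℂ) ≠ 0 := by
    intro h0
    apply hbot
    rw [Submodule.eq_bot_iff]
    intro w hw
    obtain ⟨c, hc⟩ := hv ⟨w, hw⟩
    have := congrArg Subtype.val hc
    simpa [h0] using this.symm
  have hc : ∀ j, ∃ c : ℂ, P j *ᵥ v = c • (v : Fin 2 → ℂ) := by
    intro j
    obtain ⟨c, hc⟩ := hv ⟨_, hS j v v.2⟩
    exact ⟨c, (congrArg Subtype.val hc).symm⟩
  choose c hc using hc
  have hk : ∀ j : Fin 3, ∃ k : Fin 2, ![lam j, mu j] k = c j.castSucc := by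
    intro j
    rcases eq_or_eq_of_mulVec_eq_smul (sq_eq_of_isConj_diagonal (hP j)) hv0 (hc _) with h | h
    · exact ⟨0, h.symm⟩
    · exact ⟨1, h.symm⟩
  choose k hk using hk
  have hc3 : c 3 = sig := by
    simpa using eq_or_eq_of_mulVec_eq_smul (sq_eq_of_isConj_jordanTwo h3) hv0 (hc _)
  have hc1 : c 0 * c 1 * c 2 * c 3 = 1 := by
    have h := congrArg (· *ᵥ (v : Fin 2 → ℂ)) hprod
    simp only [← mulVec_mulVec, hc, mulVec_smul, one_mulVec] at h
    have h2 : (c 0 * c 1 * c 2 * c 3 - 1) • (v : Fin 2 → ℂ) = 0 := by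
      rw [sub_smul, one_smul, sub_eq_zero]; refine Eq.trans ?_ h; module
    exact sub_eq_zero.1 ((smul_eq_zero.1 h2).resolve_right hv0)
  -- The eigenvalues on a common eigenvector give a relation with `m = 1`. It cannot be the basic
  -- one, which selects `sig` twice out of its multiplicity `4`.
  let Φ : Fin 4 → Finset I4 :=
    ![{Sum.inl (k 0)}, {Sum.inl (k 1)}, {Sum.inl (k 2)}, {Sum.inl 0}]
  have hΦ : IsNongenericityRelation (eigenvalues lam mu sig) Φ := by
    refine ⟨⟨1, one_pos, by simp, fun j => by fin_cases j <;> simp [Φ]⟩, ?_⟩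
    have e0 := hk 0
    have e1 := hk 1
    have e2 := hk 2
    rw [← hc1, hc3, Fin.prod_univ_four]
    simp only [Φ, eigenvalues, cons_val_zero, cons_val_one, cons_val, Finset.prod_singleton,
      Sum.elim_inl, e0, e1, e2]
    rfl
  have h := hrel Φ hΦ 3 sig
  have h1 : ((Φ 3).filter (fun i => eigenvalues lam mu sig 3 i = sig)).card ≤ 1 :=
    (Finset.card_filter_le _ _).trans (by simp [Φ])
  have h2 : (Finset.univ.filter (fun i => eigenvalues lam mu sig 3 i = sig)).card = 4 := by
    simp [eigenvalues]
  rw [h2] at h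
  have : 4 ≤ 2 * 1 := by
    rw [← h]; refine Nat.mul_le_mul_left 2 ?_
    convert h1
  omega

/-! ### Integrating the first-order deformation. -/

lemma mul_self_eq_zero_of_trace_det {R : Matrix (Fin 2) (Fin 2) ℂ} (htr : R.trace = 0)
    (hdet : R.det = 0) : R * R = 0 := by
  rw [trace_fin_two] at htr
  rw [det_fin_two] at hdet
  have h11 : R 1 1 = - R 0 0 := by linear_combination htr
  rw [h11] at hdet
  ext i j
  fin_cases i <;> fin_cases j <;> simp [mul_apply, h11]
  · linear_combination -hdet
  · ring
  · ring
  · linear_combination -hdet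

lemma det_eq_of_isConj {n : Type} [Fintype n] [DecidableEq n] {A B : Matrix n n ℂ} (h : IsConj A B) :
    A.det = B.det := by
  obtain ⟨g, hg⟩ := h
  have h := congrArg det hg.eq
  rw [det_mul, det_mul, mul_comm] at h
  exact mul_right_cancel₀ ((isUnit_iff_isUnit_det _).1 g.isUnit).ne_zero h

open scoped Matrix.Norms.Operator in
/-- The first-order deformation `R` of `N` is tangent to a curve of quadruples `P t` whose last
matrix is a Jordan block for `t ≠ 0`. -/
lemma exists_deformation {lam mu : Fin 3 → ℂ} {sig : ℂ} (hsig : sig ≠ 0)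
    (hne : ∀ j, lam j ≠ mu j) (hrel : IsRelativelyGeneric (eigenvalues lam mu sig))
    {N R : Quad (Fin 2)} (hN : IsNQuad lam mu sig N)
    (hB : (fun j => fromBlocks (N j) (R j) 0 (N j)) ∈ V lam mu sig) :
    ∃ P : ℂ → Quad (Fin 2), (∀ᶠ t in 𝓝[≠] 0, IsPQuad lam mu sig (P t)) ∧
      (∀ j, Tendsto (fun t => P t j) (𝓝[≠] 0) (𝓝 (N j))) ∧
      ∀ j, Tendsto (fun t => t⁻¹ • (P t j - N j)) (𝓝[≠] 0) (𝓝 (R j)) := by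
  obtain ⟨hBc, hB3, hBp⟩ := hB
  obtain ⟨hNc, hN3, hNp, hNi⟩ := hN
  dsimp only at hBc hB3 hBp
  have hc : sig⁻¹ ≠ 0 := inv_ne_zero hsig
  have hprod : N 0 * N 1 * N 2 = sig⁻¹ • 1 := by
    rw [hN3, mul_smul_comm, mul_one] at hNp
    rw [← hNp, smul_smul, inv_mul_cancel₀ hsig, one_smul]
  choose Z hZ using fun j => exists_commutator_of_isConj_diagonal (hne j) (hBc j)
  rw [hN3] at hB3
  obtain ⟨hR0, hRdet⟩ := ne_zero_and_det_eq_zero_of_isConj hB3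
  have hZ0 : R 0 = Z 0 * N 0 - N 0 * Z 0 := hZ 0
  have hZ1 : R 1 = Z 1 * N 1 - N 1 * Z 1 := hZ 1
  have hZ2 : R 2 = Z 2 * N 2 - N 2 * Z 2 := hZ 2
  -- This is the upper right block of the relation that the four block matrices multiply to `1`.
  have hX : (Z 0 * N 0 - N 0 * Z 0) * N 1 * N 2 + N 0 * (Z 1 * N 1 - N 1 * Z 1) * N 2 +
      N 0 * N 1 * (Z 2 * N 2 - N 2 * Z 2) = -(sig⁻¹ * sig⁻¹) • R 3 := by
    rw [← hZ0, ← hZ1, ← hZ2]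
    simp only [fromBlocks_multiply, ← fromBlocks_one, fromBlocks_inj] at hBp
    obtain ⟨-, h, -, -⟩ := hBp
    simp only [mul_zero, add_zero, hprod, hN3, mul_smul_comm, mul_one,
      smul_mul_assoc, one_mul] at h
    have h' : sig • (R 0 * N 1 * N 2 + N 0 * R 1 * N 2 + N 0 * N 1 * R 2) = -(sig⁻¹ • R 3) := by
      rw [eq_neg_iff_add_eq_zero, ← h, add_mul]
      abel_nf
    rw [neg_smul, mul_smul, ← smul_neg, ← h', smul_smul, inv_mul_cancel₀ hsig, one_smul]
  have hcyc : ∀ {A B : Matrix (Fin 2) (Fin 2) ℂ}, A * B = sig⁻¹ • 1 → B * A = sig⁻¹ • 1 := by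
    intro A B hAB
    have h : A * (sig • B) = 1 := by
      rw [mul_smul_comm, hAB, smul_smul, mul_inv_cancel₀ hsig, one_smul]
    have h' := mul_eq_one_comm.1 h
    rw [smul_mul_assoc] at h'
    rw [← h', smul_smul, inv_mul_cancel₀ hsig, one_smul]
  -- Since the product `N 0 * N 1 * N 2` is scalar, so are its cyclic rotations, and the two traces
  -- coming from each commutator cancel.
  have hRtr : (R 3).trace = 0 := by
    have h1 : N 1 * N 2 * N 0 = sig⁻¹ • 1 := hcyc (by rw [← mul_assoc, hprod])
    have h2 : N 2 * (N 0 * N 1) = sig⁻¹ • 1 := hcyc hprod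
    have h := congrArg trace hX
    have e : (Z 0 * N 0 - N 0 * Z 0) * N 1 * N 2 + N 0 * (Z 1 * N 1 - N 1 * Z 1) * N 2 +
        N 0 * N 1 * (Z 2 * N 2 - N 2 * Z 2) = Z 0 * (N 0 * N 1 * N 2) - N 0 * (Z 0 * (N 1 * N 2)) +
        (N 0 * (Z 1 * (N 1 * N 2)) - (N 0 * N 1) * (Z 1 * N 2)) +
        ((N 0 * N 1) * (Z 2 * N 2) - (N 0 * N 1 * N 2) * Z 2) := by noncomm_ring
    rw [e] at h
    simp only [trace_add, trace_sub] at h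
    rw [trace_mul_comm (N 0) (Z 0 * _), trace_mul_comm (N 0) (Z 1 * _),
      trace_mul_comm (N 0 * N 1) (Z 1 * _), trace_mul_comm (N 0 * N 1) (Z 2 * _),
      mul_assoc (Z 0), mul_assoc (Z 1), mul_assoc (Z 1), mul_assoc (Z 2), h1, h2, hprod] at h
    simpa [hsig] using h.symm
  have hRR := mul_self_eq_zero_of_trace_det hRtr hRdet
  obtain ⟨s, C, hs, hC0, hCd, hCc, he⟩ := exists_conj_curves
    (fun j : Fin 3 => N j.castSucc) Z (exists_smul_add_sum_eq hNi hc hprod hN3)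
  -- The last matrix moves on a straight line; as `R 3 * R 3 = 0`, its inverse is exactly `sig⁻¹ • 1
  -- - (t * (sig⁻¹ * sig⁻¹)) • R 3`, the line followed by the scaled product of the other three.
  let P : ℂ → Quad (Fin 2) := fun t => ![C 0 t, C 1 t, C 2 t, sig • 1 + t • R 3]
  have hP0 : ∀ j, P 0 j = N j := by
    intro j
    fin_cases j
    · exact hC0 0
    · exact hC0 1
    · exact hC0 2
    · simp [P, hN3]
  have hPd : ∀ j, HasDerivAt (fun t => P t j) (R j) 0 := by
    intro j
    fin_cases j
    · exact (hZ 0) ▸ hCd 0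
    · exact (hZ 1) ▸ hCd 1
    · exact (hZ 2) ▸ hCd 2
    · change HasDerivAt (fun t : ℂ => sig • (1 : Matrix (Fin 2) (Fin 2) ℂ) + t • R 3) (R 3) 0
      have h := ((hasDerivAt_id (0 : ℂ)).smul_const (R 3)).const_add
        (sig • (1 : Matrix (Fin 2) (Fin 2) ℂ))
      rw [one_smul] at h
      exact h
  refine ⟨P, ?_, fun j => ?_, fun j => ?_⟩
  · have hs2 : ∀ᶠ t in 𝓝 (0 : ℂ), s t ≠ -2 := hs.eventually_ne (by norm_num)
    filter_upwards [he.filter_mono nhdsWithin_le_nhds, hs2.filter_mono nhdsWithin_le_nhds,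
      self_mem_nhdsWithin] with t ht hst ht0
    have ht0 : t ≠ 0 := ht0
    have hPc : ∀ j : Fin 3, IsConj (N j.castSucc) (P t j.castSucc) := by
      intro j
      fin_cases j
      · exact hCc 0 t
      · exact hCc 1 t
      · exact hCc 2 t
    have hP3 : IsConj (jordanTwo sig) (P t 3) :=
      isConj_jordanTwo (smul_ne_zero ht0 hR0) (by rw [trace_smul, hRtr, smul_zero])
        (by rw [det_smul, hRdet, mul_zero])
    have hmul : (1 + s t) • (P t 0 * P t 1 * P t 2 * P t 3) = 1 := by
      have ht' : (1 + s t) • (P t 0 * P t 1 * P t 2) = N 0 * N 1 * N 2 + t •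
        ((Z 0 * N 0 - N 0 * Z 0) * N 1 * N 2 + N 0 * (Z 1 * N 1 - N 1 * Z 1) * N 2 +
          N 0 * N 1 * (Z 2 * N 2 - N 2 * Z 2)) := ht
      rw [← smul_mul_assoc, ht', hX, hprod]
      change _ * (sig • 1 + t • R 3) = _
      simp only [add_mul, mul_add, smul_mul_assoc, mul_smul_comm, one_mul, mul_one, hRR,
        smul_zero, add_zero, smul_add, smul_smul, mul_inv_cancel₀ hsig, one_smul]
      rw [add_assoc, ← add_smul]
      have h0 : sig * (t * -(sig⁻¹ * sig⁻¹)) + t * sig⁻¹ = 0 := by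
        field_simp
        ring
      rw [h0, zero_smul, add_zero]
    have hdet : (P t 0 * P t 1 * P t 2 * P t 3).det = 1 := by
      have hdN := congrArg det hNp
      have e0 : (N 0).det = (P t 0).det := det_eq_of_isConj (hPc 0)
      have e1 : (N 1).det = (P t 1).det := det_eq_of_isConj (hPc 1)
      have e2 : (N 2).det = (P t 2).det := det_eq_of_isConj (hPc 2)
      have e3 : (N 3).det = (P t 3).det := by
        rw [← det_eq_of_isConj hP3, hN3]
        simp [jordanTwo, det_fin_two, sq]
      rw [det_mul, det_mul, det_mul, det_one] at hdN
      rw [det_mul, det_mul, det_mul, ← e0, ← e1, ← e2, ← e3, hdN]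
    have hs1 : s t = 0 := by
      have h := congrArg det hmul
      rw [det_smul, hdet, det_one, Fintype.card_fin, mul_one] at h
      have h' : s t * (s t + 2) = 0 := by linear_combination h
      exact (mul_eq_zero.1 h').resolve_right fun h => hst (eq_neg_of_add_eq_zero_left h)
    rw [hs1, add_zero, one_smul] at hmul
    have hPd : ∀ j : Fin 3, IsConj (diagonal ![lam j, mu j]) (P t j.castSucc) :=
      fun j => (hNc j).trans (hPc j)
    exact ⟨hPd, hP3, hmul, isIrreducibleQuad_of_isRelativelyGeneric hrel hPd hP3 hmul⟩
  · have := (hPd j).continuousAt.tendsto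
    rw [hP0] at this
    exact this.mono_left nhdsWithin_le_nhds
  · have := hasDerivAt_iff_tendsto_slope_zero.1 (hPd j)
    simp only [zero_add, hP0] at this
    exact this

/-! ### Block matrices and passage to the limit. -/

lemma mem_V_of_conj {lam mu : Fin 3 → ℂ} {sig : ℂ} {M B : Quad I4} {G : GL I4 ℂ}
    (h : ∀ j, M j = (G : Matrix I4 I4 ℂ) * B j * ((G⁻¹ : GL I4 ℂ) : Matrix I4 I4 ℂ))
    (hB : B ∈ V lam mu sig) : M ∈ V lam mu sig := by
  have hGG : ((G⁻¹ : GL I4 ℂ) : Matrix I4 I4 ℂ) * (G : Matrix I4 I4 ℂ) = 1 := by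
    rw [← Units.val_mul, inv_mul_cancel, Units.val_one]
  have hGG' : (G : Matrix I4 I4 ℂ) * ((G⁻¹ : GL I4 ℂ) : Matrix I4 I4 ℂ) = 1 := by
    rw [← Units.val_mul, mul_inv_cancel, Units.val_one]
  have hconj : ∀ j, IsConj (B j) (M j) := fun j => by
    refine ⟨G, ?_⟩
    rw [SemiconjBy, h, mul_assoc _ _ (G : Matrix I4 I4 ℂ), hGG, mul_one]
  refine ⟨fun j => (hB.1 j).trans (hconj _), hB.2.1.trans (hconj _), ?_⟩
  have key : ∀ X Y : Matrix I4 I4 ℂ,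
      (G : Matrix I4 I4 ℂ) * X * ((G⁻¹ : GL I4 ℂ) : Matrix I4 I4 ℂ) *
        ((G : Matrix I4 I4 ℂ) * Y * ((G⁻¹ : GL I4 ℂ) : Matrix I4 I4 ℂ)) =
        (G : Matrix I4 I4 ℂ) * (X * Y) * ((G⁻¹ : GL I4 ℂ) : Matrix I4 I4 ℂ) := fun X Y => by
    calc _ = (G : Matrix I4 I4 ℂ) * X * (((G⁻¹ : GL I4 ℂ) : Matrix I4 I4 ℂ) *
        (G : Matrix I4 I4 ℂ)) * Y * ((G⁻¹ : GL I4 ℂ) : Matrix I4 I4 ℂ) := by simp only [mul_assoc]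
      _ = _ := by rw [hGG, mul_one]; simp only [mul_assoc]
  rw [h 0, h 1, h 2, h 3, key, key, key, hB.2.2, mul_one, hGG']

lemma isConj_fromBlocks_diagonal {A A' B B' : Matrix (Fin 2) (Fin 2) ℂ} (hA : IsConj A A')
    (hB : IsConj B B') :
    IsConj (fromBlocks A 0 0 B : Matrix I4 I4 ℂ) (fromBlocks A' 0 0 B') := by
  obtain ⟨g, hg⟩ := hA
  obtain ⟨k, hk⟩ := hB
  refine ⟨⟨fromBlocks (g : Matrix (Fin 2) (Fin 2) ℂ) 0 0 (k : Matrix (Fin 2) (Fin 2) ℂ),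
    fromBlocks ((g⁻¹ : GL (Fin 2) ℂ) : Matrix (Fin 2) (Fin 2) ℂ) 0 0
      ((k⁻¹ : GL (Fin 2) ℂ) : Matrix (Fin 2) (Fin 2) ℂ), ?_, ?_⟩, ?_⟩
  · simp only [fromBlocks_multiply, ← Units.val_mul, mul_inv_cancel, Units.val_one, mul_zero,
      zero_mul, add_zero, zero_add, fromBlocks_one]
  · simp only [fromBlocks_multiply, ← Units.val_mul, inv_mul_cancel, Units.val_one, mul_zero,
      zero_mul, add_zero, zero_add, fromBlocks_one]
  · simp only [SemiconjBy, fromBlocks_multiply, hg.eq, hk.eq, mul_zero, zero_mul, add_zero,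
      zero_add]

/-- Needed because `V` puts the Jordan block first, while in the direct sum of `N` and `P` it comes
second. -/
lemma isConj_fromBlocks_swap (A B : Matrix (Fin 2) (Fin 2) ℂ) :
    IsConj (fromBlocks A 0 0 B : Matrix I4 I4 ℂ) (fromBlocks B 0 0 A) := by
  have h : (fromBlocks 0 1 1 0 : Matrix I4 I4 ℂ) * fromBlocks 0 1 1 0 = 1 := by
    simp [fromBlocks_multiply]
  exact ⟨⟨fromBlocks 0 1 1 0, fromBlocks 0 1 1 0, h, h⟩, by
    simp [SemiconjBy, fromBlocks_multiply]⟩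

lemma fromBlocks_mem_V {lam mu : Fin 3 → ℂ} {sig : ℂ} {N P : Quad (Fin 2)}
    (hN : IsNQuad lam mu sig N) (hP : IsPQuad lam mu sig P) :
    (fun j => fromBlocks (N j) 0 0 (P j)) ∈ V lam mu sig := by
  refine ⟨fun j => ?_, ?_, ?_⟩
  · rw [← fromBlocks_diagonal]
    exact isConj_fromBlocks_diagonal (hN.1 j) (hP.1 j)
  · dsimp only
    rw [hN.2.1]
    exact (isConj_fromBlocks_swap _ _).trans (isConj_fromBlocks_diagonal (IsConj.refl _) hP.2.1)
  · simp only [fromBlocks_multiply, mul_zero, zero_mul, add_zero, zero_add, hN.2.2.1, hP.2.2.1,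
      fromBlocks_one]

/-- The block unipotent matrix with upper right block `a • 1`. -/
def blockUnipotent (a : ℂ) : GL I4 ℂ where
  val := fromBlocks 1 (a • 1) 0 1
  inv := fromBlocks 1 (-a • 1) 0 1
  val_inv := by simp [fromBlocks_multiply]
  inv_val := by simp [fromBlocks_multiply]

/-- With `a = t⁻¹`, `A = N j`, `B = P t j` the corner becomes the difference quotient that tends to
`R j`. -/
lemma blockUnipotent_conj (a : ℂ) (A B : Matrix (Fin 2) (Fin 2) ℂ) :
    (blockUnipotent a : Matrix I4 I4 ℂ) * fromBlocks A 0 0 B *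
      (((blockUnipotent a)⁻¹ : GL I4 ℂ) : Matrix I4 I4 ℂ) = fromBlocks A (a • (B - A)) 0 B := by
  change fromBlocks 1 (a • 1) 0 1 * fromBlocks A 0 0 B * fromBlocks 1 (-a • 1) 0 1 = _
  simp [fromBlocks_multiply, sub_eq_neg_add]

lemma tendsto_conj_fromBlocks {α : Type*} {l : Filter α} (G : GL I4 ℂ)
    (A : Matrix (Fin 2) (Fin 2) ℂ) {u v : α → Matrix (Fin 2) (Fin 2) ℂ}
    {x y : Matrix (Fin 2) (Fin 2) ℂ} (hu : Tendsto u l (𝓝 x)) (hv : Tendsto v l (𝓝 y)) :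
    Tendsto (fun t => (G : Matrix I4 I4 ℂ) * fromBlocks A (u t) 0 (v t) *
      ((G⁻¹ : GL I4 ℂ) : Matrix I4 I4 ℂ)) l
      (𝓝 ((G : Matrix I4 I4 ℂ) * fromBlocks A x 0 y * ((G⁻¹ : GL I4 ℂ) : Matrix I4 I4 ℂ))) := by
  have h : Continuous fun p : Matrix (Fin 2) (Fin 2) ℂ × Matrix (Fin 2) (Fin 2) ℂ =>
      (fromBlocks A p.1 0 p.2 : Matrix I4 I4 ℂ) :=
    Continuous.matrix_fromBlocks continuous_const continuous_fst continuous_const continuous_snd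
  have h' : Tendsto (fun t => (fromBlocks A (u t) 0 (v t) : Matrix I4 I4 ℂ)) l
      (𝓝 (fromBlocks A x 0 y)) := (h.tendsto (x, y)).comp (hu.prodMk_nhds hv)
  exact (h'.const_mul _).mul_const _

end DeligneSimpson

theorem mainTheorem5 (lam mu : Fin 3 → ℂ) (sig : ℂ)
    (hlam : ∀ j, lam j ≠ 0) (hmu : ∀ j, mu j ≠ 0) (hsig : sig ≠ 0)
    (hne : ∀ j, lam j ≠ mu j)
    (hrel : DeligneSimpson.IsRelativelyGeneric (DeligneSimpson.eigenvalues lam mu sig))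
    (hnon : ¬ DeligneSimpson.IsGeneric (DeligneSimpson.eigenvalues lam mu sig)) :
    DeligneSimpson.W lam mu sig ⊆ closure (DeligneSimpson.U lam mu sig) := by
  open DeligneSimpson Filter Topology in
  rintro M ⟨hMV, N, R, G, hN, hM⟩
  have hB : (fun j => fromBlocks (N j) (R j) 0 (N j)) ∈ V lam mu sig := by
    refine mem_V_of_conj (G := G⁻¹) (fun j => ?_) hMV
    rw [hM, inv_inv]
    simp only [mul_assoc]
    rw [← Units.val_mul, inv_mul_cancel, Units.val_one, mul_one, ← mul_assoc, ← Units.val_mul,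
      inv_mul_cancel, Units.val_one, one_mul]
  obtain ⟨P, hP, hPN, hPR⟩ := exists_deformation hsig hne hrel hN hB
  refine mem_closure_of_tendsto (b := 𝓝[≠] (0 : ℂ))
    (f := fun t j => (G : Matrix I4 I4 ℂ) * fromBlocks (N j) (t⁻¹ • (P t j - N j)) 0 (P t j) *
      ((G⁻¹ : GL I4 ℂ) : Matrix I4 I4 ℂ)) ?_ ?_
  · rw [tendsto_pi_nhds]
    intro j
    rw [hM]
    exact tendsto_conj_fromBlocks G (N j) (hPR j) (hPN j)
  · filter_upwards [hP] with t ht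
    have h : ∀ j, (G : Matrix I4 I4 ℂ) * fromBlocks (N j) (t⁻¹ • (P t j - N j)) 0 (P t j) *
        ((G⁻¹ : GL I4 ℂ) : Matrix I4 I4 ℂ) = ((G * blockUnipotent t⁻¹ : GL I4 ℂ) :
          Matrix I4 I4 ℂ) * fromBlocks (N j) 0 0 (P t j) *
            (((G * blockUnipotent t⁻¹)⁻¹ : GL I4 ℂ) : Matrix I4 I4 ℂ) := by
      intro j
      rw [← blockUnipotent_conj, _root_.mul_inv_rev, Units.val_mul, Units.val_mul]
      simp only [mul_assoc]
    exact ⟨mem_V_of_conj h (fromBlocks_mem_V hN ht), N, P t, _, hN, ht, h⟩
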